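/- Let $\alpha>0$, $0<\sigma<1$, $c>-\sigma$, and let $$\nu(dx)=\alpha\frac{\Gamma(1+c)}{\Gamma(1-\sigma)\Gamma(c+\sigma)}\,x^{-\sigma-1}(1-x)^{c+\sigma-1}\,dx\qquad\text{on }(0,1)$$ be the Lévy measure of the stable beta process. Let $\mathcal V$ be a standard Borel space of potential vertices, $H$ a non-atomic probability measure on $\mathcal V$, and $\mu=\sum_{i}\mu_i\delta_{\theta_i}$ a stable beta process, i.e. the points $(\mu_i,\theta_i)$, $i\in\mathbb N$, form a Poisson point process with intensity $\nu\otimes H$. Given $(\mu_i,\theta_i)_i$, let $Z_{ni}$ ($n\ge 1$, $i\in\mathbb N$) be conditionally independent Bernoulli variables with $\mathbf P(Z_{ni}=1)=\mu_i$, and let the $n$-th clique be $\mathcal C_n=\{\theta_i: Z_{ni}=1\}$. For $N\ge 0$ let $G_N$ be the graph with vertex set $V_N=\mathcal C_1\cup\dots\cup\mathcal C_N$ in which two distinct vertices are joined by an edge iff both belong to $\mathcal C_n$ for some $n\le N$, and let $E_N$ be its edge set. Then $\mathbb E|E_N|$ and $\mathbb E|V_N|$ are finite for every $N$, and: 1.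 For every $N$, $$\mathbb E|E_N|=\frac12\iint\bigl(1-(1-wv)^N\bigr)\,\nu(dw)\,\nu(dv).$$ 2. As $N\to\infty$, $\ \mathbb E|E_N|=O\bigl(\min(N^{(1+\sigma)/2},\,N^{3\sigma/2})\bigr)$. 3. As $N\to\infty$, $\ \mathbb E|E_N|=O\bigl(\min\bigl((\mathbb E|V_N|)^{(1+\sigma)/(2\sigma)},\,(\mathbb E|V_N|)^{3/2}\bigr)\bigr)$. 4. The graph is sparse: $\mathbb E|E_N|=o\bigl((\mathbb E|V_N|)^2\bigr)$ as $N\to\infty$. -/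

import Mathlib

open MeasureTheory ProbabilityTheory Filter Asymptotics
open scoped ENNReal NNReal Topology

/-- The density `α Γ(1+c) / (Γ(1-σ) Γ(c+σ)) · x^(-σ-1) (1-x)^(c+σ-1)` of the Lévy measure of the
stable beta process, as a function of the atom size `x ∈ (0,1)`. -/
noncomputable def stableBetaDensity (α σ c x : ℝ) : ℝ :=
  α * (Real.Gamma (1 + c) / (Real.Gamma (1 - σ) * Real.Gamma (c + σ))) *
    x ^ (-σ - 1) * (1 - x) ^ (c + σ - 1)

/-- The Lévy measure `ν` of the stable beta process. It lives on `(0,1)`; the endpoint `1` of the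
range `(0,1]` of atom sizes is a null set. -/
noncomputable def stableBetaLevy (α σ c : ℝ) : Measure ℝ :=
  (volume.restrict (Set.Ioo 0 1)).withDensity fun x => ENNReal.ofReal (stableBetaDensity α σ c x)

/-- The counting measure `∑ i, δ_{X i}` of a sequence of points, with multiplicity. -/
noncomputable def pointMeasure {E : Type*} [MeasurableSpace E] (X : ℕ → E) : Measure E :=
  Measure.sum fun i => Measure.dirac (X i)

/-- The random points `X 0, X 1, …` form a Poisson point process with intensity measure `m`: the
number of points in a measurable set of finite intensity is Poisson with mean the intensity of the
set, and the numbers of points in finitely many disjoint measurable sets are independent. -/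
structure IsPoissonProcess {Ω E : Type*} [MeasurableSpace Ω] [MeasurableSpace E]
    (P : Measure Ω) (X : ℕ → Ω → E) (m : Measure E) : Prop where
  measurable_points : ∀ i, Measurable (X i)
  poisson_count : ∀ A : Set E, MeasurableSet A → m A ≠ ∞ →
    P.map (fun ω => pointMeasure (fun i => X i ω) A) =
      (poissonMeasure (m A).toNNReal).map (fun k : ℕ => (k : ℝ≥0∞))
  indep_count : ∀ (k : ℕ) (A : Fin k → Set E), (∀ j, MeasurableSet (A j)) →
    Pairwise (fun j l => Disjoint (A j) (A l)) →
    iIndepFun (fun j ω => pointMeasure (fun i => X i ω) (A j)) P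

/-- `∑ i, w i • δ_{θ i}` is a stable beta process `SB(c, σ, α)` on the space `𝒱` of potential
vertices, with base distribution `H`: its atoms, with sizes `w i` and locations `θ i`, form a
Poisson process with intensity `ν ⊗ H`. -/
def IsStableBetaProcess {Ω 𝒱 : Type*} [MeasurableSpace Ω] [MeasurableSpace 𝒱]
    (P : Measure Ω) (α σ c : ℝ) (H : Measure 𝒱) (w : ℕ → Ω → ℝ) (θ : ℕ → Ω → 𝒱) : Prop :=
  IsPoissonProcess P (fun i ω => (w i ω, θ i ω)) ((stableBetaLevy α σ c).prod H)

/-- The σ-algebra generated by all atom sizes and atom locations. -/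
abbrev atomSigmaAlgebra {Ω 𝒱 : Type*} [MeasurableSpace 𝒱] (w : ℕ → Ω → ℝ) (θ : ℕ → Ω → 𝒱) :
    MeasurableSpace Ω :=
  MeasurableSpace.comap (fun ω (i : ℕ) => (w i ω, θ i ω)) inferInstance

/-- Conditionally on the atoms, the entries `Z n i` of the random binary matrix `Z` (is the vertex
`θ i` in clique `n`?) are independent Bernoulli variables with success probability `w i`: for
disjoint finite sets `S`, `T` of entries, all entries in `S` are `true` and all entries in `T` are
`false` with conditional probability `∏_{(n,i) ∈ S} w i · ∏_{(n,i) ∈ T} (1 - w i)`. -/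
structure IsCliqueMatrix {Ω 𝒱 : Type*} [MeasurableSpace Ω] [MeasurableSpace 𝒱]
    (P : Measure Ω) (w : ℕ → Ω → ℝ) (θ : ℕ → Ω → 𝒱) (Z : ℕ → ℕ → Ω → Bool) : Prop where
  measurable_entry : ∀ n i, Measurable (Z n i)
  cond_bernoulli : ∀ S T : Finset (ℕ × ℕ), Disjoint S T →
    P⟦{ω | (∀ p ∈ S, Z p.1 p.2 ω = true) ∧ (∀ p ∈ T, Z p.1 p.2 ω = false)} |
        atomSigmaAlgebra w θ⟧ =ᵐ[P]
      fun ω => (∏ p ∈ S, w p.2 ω) * ∏ p ∈ T, (1 - w p.2 ω)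

/-- The `n`-th random clique, the set of all vertices selected by row `n` of the matrix. -/
def clique {Ω 𝒱 : Type*} (θ : ℕ → Ω → 𝒱) (Z : ℕ → ℕ → Ω → Bool) (n : ℕ) (ω : Ω) : Set 𝒱 :=
  {x | ∃ i, Z n i ω = true ∧ θ i ω = x}

/-- The vertices of the graph covered by the first `N` cliques: all members of these cliques. -/
def coverVertices {𝒱 : Type*} (C : ℕ → Set 𝒱) (N : ℕ) : Set 𝒱 :=
  {x | ∃ n < N, x ∈ C n}

/-- The graph covered by the first `N` cliques: two distinct points are joined iff they have at
least one of these cliques in common. (Points outside `coverVertices C N` are isolated, and are not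
counted as vertices.) -/
def coverGraph {𝒱 : Type*} (C : ℕ → Set 𝒱) (N : ℕ) : SimpleGraph 𝒱 where
  Adj x y := x ≠ y ∧ ∃ n < N, x ∈ C n ∧ y ∈ C n
  symm := ⟨fun _ _ h => ⟨h.1.symm, h.2.imp fun _ hn => ⟨hn.1, hn.2.2, hn.2.1⟩⟩⟩
  loopless := ⟨fun _ h => h.1 rfl⟩

/-- The expected number `𝔼|E|` of edges of the random graph built from the first `N` cliques. -/
noncomputable def expectedEdges {Ω 𝒱 : Type*} [MeasurableSpace Ω]
    (P : Measure Ω) (θ : ℕ → Ω → 𝒱) (Z : ℕ → ℕ → Ω → Bool) (N : ℕ) : ℝ≥0∞ :=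
  ∫⁻ ω, ((coverGraph (fun n => clique θ Z n ω) N).edgeSet.encard : ℝ≥0∞) ∂P

/-- The expected number `𝔼|V|` of vertices of the random graph built from the first `N` cliques. -/
noncomputable def expectedVertices {Ω 𝒱 : Type*} [MeasurableSpace Ω]
    (P : Measure Ω) (θ : ℕ → Ω → 𝒱) (Z : ℕ → ℕ → Ω → Bool) (N : ℕ) : ℝ≥0∞ :=
  ∫⁻ ω, ((coverVertices (fun n => clique θ Z n ω) N).encard : ℝ≥0∞) ∂P

/-!
The atoms `(w i, θ i)` enter only through their first two (factorial) moment measures. Counts of a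
Poisson process have Poisson first and second moments and are independent on disjoint sets, so that
`∑ i, law (X i)` is the intensity `m` (`IsPoissonProcess.sum_map_eq`) and
`∑ i ≠ j, law (X i, X j)` is `m ⊗ m` (`IsPoissonProcess.factorialMomentMeasure_eq`). As `H` has no
atoms, `m ⊗ m` does not charge pairs with equal locations; hence the locations are almost surely
distinct and vertices and edges may be counted by indices.

Given the atoms, the vertex `i` is covered by one of `N` cliques with probability
`1 - (1 - w i) ^ N`, and the pair `i ≠ j` with probability `1 - (1 - w i * w j) ^ N`
(`IsCliqueMatrix.measure_exists_row`). Summing over `i` and over pairs,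
`𝔼|V| = ∫ (1 - (1 - u) ^ N) ν(du)` and `𝔼|E| = ½ ∬ (1 - (1 - u v) ^ N) ν(du) ν(dv)`.

For the growth rates, let `a` be the smaller of `(1 + σ) / 2` and `3σ / 2`. Then `σ < a < 1`, so
`1 - (1 - u v) ^ N ≤ (N u v) ^ a` for `u, v ∈ (0, 1)`, and `∫ u ^ a ν(du)` is a finite beta
integral; therefore `𝔼|E| = O(N ^ a)`. Conversely the atoms of size about `1 / N` give
`𝔼|V| ≥ C N ^ σ` (`exists_le_lintegral_one_sub_pow`), which turns powers of `N` into powers of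
`𝔼|V|`. Sparsity follows from `a < 2σ`. (The true order of `𝔼|E|` is `N ^ σ log N`; it is not
needed.)
-/

/-! ### Moments of the Poisson distribution -/

/-- The Stein–Chen identity `𝔼[K g(K)] = r 𝔼[g(K + 1)]` for a Poisson variable `K` of mean `r`,
which yields all its moments. -/
lemma lintegral_cast_mul_poissonMeasure (r : ℝ≥0) (g : ℕ → ℝ≥0∞) :
    ∫⁻ k, (k : ℝ≥0∞) * g k ∂(poissonMeasure r) = r * ∫⁻ k, g (k + 1) ∂(poissonMeasure r) := by
  simp only [poissonMeasure, lintegral_sum_measure, lintegral_smul_measure, lintegral_dirac,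
    smul_eq_mul]
  rw [tsum_eq_zero_add' ENNReal.summable, ← ENNReal.tsum_mul_left]
  simp only [Nat.cast_zero, zero_mul, mul_zero, zero_add]
  refine tsum_congr fun n => ?_
  rw [← mul_assoc, ← mul_assoc]
  congr 1
  rw [← ENNReal.ofReal_natCast, ← ENNReal.ofReal_mul (by positivity), ← ENNReal.ofReal_coe_nnreal,
    ← ENNReal.ofReal_mul (by positivity)]
  congr 1
  rw [Nat.factorial_succ]
  push_cast
  field_simp
  exact pow_succ' _ _

lemma lintegral_cast_poissonMeasure (r : ℝ≥0) :
    ∫⁻ k, (k : ℝ≥0∞) ∂(poissonMeasure r) = r := by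
  simpa using lintegral_cast_mul_poissonMeasure r 1

lemma lintegral_cast_sq_poissonMeasure (r : ℝ≥0) :
    ∫⁻ k, (k : ℝ≥0∞) * k ∂(poissonMeasure r) = r * r + r := by
  rw [lintegral_cast_mul_poissonMeasure r fun k => (k : ℝ≥0∞)]
  simp only [Nat.cast_add, Nat.cast_one]
  rw [lintegral_add_right _ measurable_const, lintegral_cast_poissonMeasure]
  simp [mul_add]

/-! ### Moment measures of a Poisson process -/

lemma pointMeasure_apply {E : Type*} [MeasurableSpace E] (X : ℕ → E) {A : Set E}
    (hA : MeasurableSet A) : pointMeasure X A = ∑' i, A.indicator (fun _ => (1 : ℝ≥0∞)) (X i) := by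
  rw [pointMeasure, Measure.sum_apply _ hA]
  exact tsum_congr fun i => by rw [Measure.dirac_apply' _ hA]; rfl

/-- The second factorial moment measure of the points `X 0, X 1, …`: the expected number of pairs
`(X i, X j)` with `i ≠ j` in a subset of `E × E`. -/
noncomputable def factorialMomentMeasure {Ω E : Type*} [MeasurableSpace Ω] [MeasurableSpace E]
    (P : Measure Ω) (X : ℕ → Ω → E) : Measure (E × E) :=
  Measure.sum fun p : ℕ × ℕ => if p.1 = p.2 then 0 else P.map fun ω => (X p.1 ω, X p.2 ω)

namespace IsPoissonProcess

variable {Ω E : Type*} [MeasurableSpace Ω] [MeasurableSpace E] {P : Measure Ω} {X : ℕ → Ω → E}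
  {m : Measure E}

lemma measurable_count (h : IsPoissonProcess P X m) {A : Set E} (hA : MeasurableSet A) :
    Measurable fun ω => pointMeasure (fun i => X i ω) A := by
  simp only [pointMeasure_apply _ hA]
  exact Measurable.tsum fun i =>
    (measurable_const.indicator hA).comp (h.measurable_points i)

lemma lintegral_comp_count (h : IsPoissonProcess P X m) {A : Set E} (hA : MeasurableSet A)
    (hmA : m A ≠ ∞) {g : ℝ≥0∞ → ℝ≥0∞} (hg : Measurable g) :
    ∫⁻ ω, g (pointMeasure (fun i => X i ω) A) ∂P =
      ∫⁻ k : ℕ, g k ∂(poissonMeasure (m A).toNNReal) := by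
  rw [← lintegral_map hg (h.measurable_count hA), h.poisson_count A hA hmA,
    lintegral_map hg .of_discrete]

lemma lintegral_count (h : IsPoissonProcess P X m) {A : Set E} (hA : MeasurableSet A)
    (hmA : m A ≠ ∞) : ∫⁻ ω, pointMeasure (fun i => X i ω) A ∂P = m A := by
  refine (h.lintegral_comp_count hA hmA measurable_id).trans ?_
  simpa [hmA] using lintegral_cast_poissonMeasure (m A).toNNReal

lemma lintegral_count_sq (h : IsPoissonProcess P X m) {A : Set E} (hA : MeasurableSet A)
    (hmA : m A ≠ ∞) :
    ∫⁻ ω, pointMeasure (fun i => X i ω) A * pointMeasure (fun i => X i ω) A ∂P =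
      m A * m A + m A := by
  rw [h.lintegral_comp_count hA hmA (g := fun x => x * x) (by fun_prop),
    lintegral_cast_sq_poissonMeasure, ENNReal.coe_toNNReal hmA]

lemma lintegral_count_mul_of_disjoint (h : IsPoissonProcess P X m) {A B : Set E}
    (hA : MeasurableSet A) (hB : MeasurableSet B) (hAB : Disjoint A B) (hmA : m A ≠ ∞)
    (hmB : m B ≠ ∞) :
    ∫⁻ ω, pointMeasure (fun i => X i ω) A * pointMeasure (fun i => X i ω) B ∂P = m A * m B := by
  have hi := h.indep_count 2 ![A, B] (by intro j; fin_cases j <;> simpa)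
    (by intro j l hjl; fin_cases j <;> fin_cases l <;> simp_all [hAB.symm])
  have hi2 := hi.indepFun (i := 0) (j := 1) (by decide)
  have key := lintegral_mul_eq_lintegral_mul_lintegral_of_indepFun
    (h.measurable_count hA) (h.measurable_count hB) hi2
  rw [h.lintegral_count hA hmA, h.lintegral_count hB hmB] at key
  exact key

/-- The covariance formula for counts. Splitting `A` and `B` along `A ∩ B` reduces it to
independent counts and to the second moment of the count of `A ∩ B`. -/
lemma lintegral_count_mul (h : IsPoissonProcess P X m) {A B : Set E}
    (hA : MeasurableSet A) (hB : MeasurableSet B) (hmA : m A ≠ ∞) (hmB : m B ≠ ∞) :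
    ∫⁻ ω, pointMeasure (fun i => X i ω) A * pointMeasure (fun i => X i ω) B ∂P =
      m A * m B + m (A ∩ B) := by
  have h1 : m (A \ B) ≠ ∞ := measure_ne_top_of_subset Set.sdiff_subset hmA
  have h2 : m (A ∩ B) ≠ ∞ := measure_ne_top_of_subset Set.inter_subset_left hmA
  have h3 : m (B \ A) ≠ ∞ := measure_ne_top_of_subset Set.sdiff_subset hmB
  have e : ∀ μ : Measure E, μ A = μ (A ∩ B) + μ (A \ B) ∧ μ B = μ (A ∩ B) + μ (B \ A) :=
    fun μ => ⟨(measure_inter_add_sdiff A hB).symm, by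
      rw [Set.inter_comm]; exact (measure_inter_add_sdiff B hA).symm⟩
  have m1 := h.measurable_count (hA.diff hB)
  have m2 := h.measurable_count (hA.inter hB)
  have m3 := h.measurable_count (hB.diff hA)
  calc _ = ∫⁻ ω, ((pointMeasure (fun i => X i ω) (A ∩ B) * pointMeasure (fun i => X i ω) (A ∩ B) +
            pointMeasure (fun i => X i ω) (A ∩ B) * pointMeasure (fun i => X i ω) (B \ A)) +
            pointMeasure (fun i => X i ω) (A \ B) * pointMeasure (fun i => X i ω) (A ∩ B)) +
            pointMeasure (fun i => X i ω) (A \ B) * pointMeasure (fun i => X i ω) (B \ A) ∂P := by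
        refine lintegral_congr fun ω => ?_
        rw [(e (pointMeasure fun i => X i ω)).1, (e (pointMeasure fun i => X i ω)).2]
        ring
    _ = _ := by
        rw [lintegral_add_left (by fun_prop), lintegral_add_left (by fun_prop),
          lintegral_add_left (by fun_prop), h.lintegral_count_sq (hA.inter hB) h2,
          h.lintegral_count_mul_of_disjoint (hA.inter hB) (hB.diff hA)
            (Set.disjoint_left.2 fun x hx hx' => hx'.2 hx.1) h2 h3,
          h.lintegral_count_mul_of_disjoint (hA.diff hB) (hA.inter hB)
            (Set.disjoint_left.2 fun x hx hx' => hx.2 hx'.2) h1 h2,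
          h.lintegral_count_mul_of_disjoint (hA.diff hB) (hB.diff hA)
            (Set.disjoint_left.2 fun x hx hx' => hx.2 hx'.1) h1 h3, (e m).1, (e m).2]
        ring

lemma sum_map_apply (h : IsPoissonProcess P X m) {A : Set E} (hA : MeasurableSet A) :
    (Measure.sum fun i => P.map (X i)) A = ∫⁻ ω, pointMeasure (fun i => X i ω) A ∂P := by
  have hmeas : ∀ i, Measurable fun ω => A.indicator (fun _ => (1 : ℝ≥0∞)) (X i ω) := fun i =>
    (measurable_const.indicator hA).comp (h.measurable_points i)
  simp only [pointMeasure_apply _ hA]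
  rw [lintegral_tsum fun i => (hmeas i).aemeasurable,
    Measure.sum_apply _ hA]
  refine tsum_congr fun i => ?_
  rw [← lintegral_map (f := A.indicator fun _ => (1 : ℝ≥0∞)) (measurable_const.indicator hA)
    (h.measurable_points i), lintegral_indicator_const hA, one_mul]

/-- Campbell's theorem: the first moment measure of a Poisson process is its intensity. -/
theorem sum_map_eq [SigmaFinite m] (h : IsPoissonProcess P X m) :
    (Measure.sum fun i => P.map (X i)) = m := by
  refine (Measure.ext_iff_of_iUnion_eq_univ (iUnion_spanningSets m)).2 fun n => ?_
  ext A hA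
  have hS := measurableSet_spanningSets m n
  rw [Measure.restrict_apply hA, Measure.restrict_apply hA, h.sum_map_apply (hA.inter hS),
    h.lintegral_count (hA.inter hS)
      (measure_ne_top_of_subset Set.inter_subset_right (measure_spanningSets_lt_top m n).ne)]

/-- A product of counts is a sum over all pairs of indices: the off-diagonal pairs contribute the
factorial moment measure, the diagonal ones the first moment measure of `A ∩ B`. -/
lemma lintegral_count_mul_eq_factorialMomentMeasure_add (h : IsPoissonProcess P X m) {A B : Set E}
    (hA : MeasurableSet A) (hB : MeasurableSet B) :
    ∫⁻ ω, pointMeasure (fun i => X i ω) A * pointMeasure (fun i => X i ω) B ∂P =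
      factorialMomentMeasure P X (A ×ˢ B) + (Measure.sum fun i => P.map (X i)) (A ∩ B) := by
  have hpair : ∀ p : ℕ × ℕ, Measurable fun ω => (X p.1 ω, X p.2 ω) := fun p =>
    (h.measurable_points p.1).prodMk (h.measurable_points p.2)
  have hAB := hA.prod hB
  have hprod : ∀ ω, pointMeasure (fun i => X i ω) A * pointMeasure (fun i => X i ω) B =
      ∑' p : ℕ × ℕ, (A ×ˢ B).indicator (fun _ => (1 : ℝ≥0∞)) (X p.1 ω, X p.2 ω) := by
    intro ω
    rw [pointMeasure_apply _ hA, pointMeasure_apply _ hB, ← ENNReal.tsum_mul_right,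
      ENNReal.tsum_prod']
    refine tsum_congr fun i => ?_
    rw [← ENNReal.tsum_mul_left]
    refine tsum_congr fun j => ?_
    simp only [Set.indicator, Set.mem_prod]
    by_cases h1 : X i ω ∈ A <;> by_cases h2 : X j ω ∈ B <;> simp [h1, h2]
  have hmeas : ∀ p : ℕ × ℕ, Measurable fun ω =>
      (A ×ˢ B).indicator (fun _ => (1 : ℝ≥0∞)) (X p.1 ω, X p.2 ω) := fun p =>
    (measurable_const.indicator hAB).comp (hpair p)
  simp only [hprod]
  rw [lintegral_tsum fun p => (hmeas p).aemeasurable]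
  have hterm : ∀ p : ℕ × ℕ,
      ∫⁻ ω, (A ×ˢ B).indicator (fun _ => (1 : ℝ≥0∞)) (X p.1 ω, X p.2 ω) ∂P =
        (if p.1 = p.2 then 0 else P.map fun ω => (X p.1 ω, X p.2 ω)) (A ×ˢ B) +
        if p.1 = p.2 then P.map (X p.1) (A ∩ B) else 0 := by
    intro p
    rw [← lintegral_map (f := (A ×ˢ B).indicator fun _ => (1 : ℝ≥0∞))
      (measurable_const.indicator hAB) (hpair p), lintegral_indicator_const hAB, one_mul]
    split_ifs with hp
    · rw [Measure.map_apply (hpair p) hAB,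
        Measure.map_apply (h.measurable_points _) (hA.inter hB), ← hp]
      exact (zero_add _).symm
    · simp
  simp only [hterm]
  rw [ENNReal.tsum_add, factorialMomentMeasure, Measure.sum_apply _ hAB,
    Measure.sum_apply _ (hA.inter hB)]
  congr 1
  rw [ENNReal.tsum_prod']
  exact tsum_congr fun i => by simp

/-- The second factorial moment measure of a Poisson process is the square of its intensity. -/
theorem factorialMomentMeasure_eq [SigmaFinite m] (h : IsPoissonProcess P X m) :
    factorialMomentMeasure P X = m.prod m := by
  have hcover : ⋃ n, spanningSets m n ×ˢ spanningSets m n = Set.univ := by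
    rw [Set.iUnion_prod_of_monotone (monotone_spanningSets m) (monotone_spanningSets m),
      iUnion_spanningSets, Set.univ_prod_univ]
  refine (Measure.ext_iff_of_iUnion_eq_univ hcover).2 fun n => ?_
  have hS := measurableSet_spanningSets m n
  have hfin : ∀ A : Set E, m (A ∩ spanningSets m n) ≠ ∞ := fun A =>
    measure_ne_top_of_subset Set.inter_subset_right (measure_spanningSets_lt_top m n).ne
  rw [← Measure.prod_restrict]
  symm
  refine Measure.prod_eq fun A B hA hB => ?_
  have hA' := hA.inter hS
  have hB' := hB.inter hS
  rw [Measure.restrict_apply (hA.prod hB), Measure.restrict_apply hA, Measure.restrict_apply hB,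
    Set.prod_inter_prod]
  have key := h.lintegral_count_mul_eq_factorialMomentMeasure_add hA' hB'
  rw [h.lintegral_count_mul hA' hB' (hfin A) (hfin B), h.sum_map_eq] at key
  have hne : m (A ∩ spanningSets m n ∩ (B ∩ spanningSets m n)) ≠ ∞ :=
    measure_ne_top_of_subset Set.inter_subset_left (hfin A)
  exact ((ENNReal.add_left_inj hne).1 key).symm

end IsPoissonProcess

/-! ### Probability that a set of vertices is covered by one of the cliques -/

lemma prod_indicator_row {Ω : Type*} (Z : ℕ → ℕ → Ω → Bool) (F S : Finset ℕ) (ω : Ω) :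
    ∏ n ∈ S, {ω | ∀ i ∈ F, Z n i ω = true}.indicator (fun _ => (1 : ℝ)) ω =
      {ω | ∀ p ∈ S ×ˢ F, Z p.1 p.2 ω = true}.indicator (fun _ => (1 : ℝ)) ω := by
  simp only [Set.indicator_apply, Set.mem_ofPred_eq, Finset.prod_boole]
  refine if_congr ?_ rfl rfl
  simp only [Finset.mem_product, Prod.forall]
  exact ⟨fun h n i hp => h n hp.1 i hp.2, fun h n hn i hi => h n i ⟨hn, hi⟩⟩

namespace IsCliqueMatrix

variable {Ω 𝒱 : Type*} [MeasurableSpace Ω] [MeasurableSpace 𝒱] {P : Measure Ω}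
  {w : ℕ → Ω → ℝ} {θ : ℕ → Ω → 𝒱} {Z : ℕ → ℕ → Ω → Bool}

lemma measurableSet_forall_true (h : IsCliqueMatrix P w θ Z) (S : Finset (ℕ × ℕ)) :
    MeasurableSet {ω | ∀ p ∈ S, Z p.1 p.2 ω = true} := by
  have : {ω | ∀ p ∈ S, Z p.1 p.2 ω = true} = ⋂ p ∈ S, Z p.1 p.2 ⁻¹' {true} := by
    ext; simp
  rw [this]
  exact Finset.measurableSet_biInter _ fun p _ => h.measurable_entry _ _ (measurableSet_singleton _)

lemma measureReal_forall_true [IsProbabilityMeasure P] (h : IsCliqueMatrix P w θ Z)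
    (hX : ∀ i, Measurable fun ω => (w i ω, θ i ω)) (S : Finset (ℕ × ℕ)) :
    P.real {ω | ∀ p ∈ S, Z p.1 p.2 ω = true} = ∫ ω, ∏ p ∈ S, w p.2 ω ∂P := by
  have hm : atomSigmaAlgebra w θ ≤ ‹MeasurableSpace Ω› := (measurable_pi_lambda _ hX).comap_le
  have key := h.cond_bernoulli S ∅ (Finset.disjoint_empty_right S)
  simp only [Finset.notMem_empty, false_imp_iff, imp_true_iff, and_true, Finset.prod_empty,
    mul_one] at key
  rw [← integral_congr_ae key, integral_condExp hm,
    integral_indicator_const _ (h.measurableSet_forall_true S)]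
  simp

lemma measurableSet_exists_row (h : IsCliqueMatrix P w θ Z) (F : Finset ℕ) (N : ℕ) :
    MeasurableSet {ω | ∃ n < N, ∀ i ∈ F, Z n i ω = true} := by
  have : {ω | ∃ n < N, ∀ i ∈ F, Z n i ω = true} =
      ⋃ n ∈ Finset.range N, ⋂ i ∈ F, Z n i ⁻¹' {true} := by
    ext; simp
  rw [this]
  exact Finset.measurableSet_biUnion _ fun n _ => Finset.measurableSet_biInter _ fun i _ =>
    h.measurable_entry _ _ (measurableSet_singleton _)

/-- The probability that some row `n < N` selects every column in `F`. Expanding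
`∏ n < N, (1 - 1{row n selects F})` over subsets of rows, and back after taking expectations, only
uses the probabilities that a given finite set of entries is `true`. -/
lemma measure_exists_row [IsProbabilityMeasure P] (h : IsCliqueMatrix P w θ Z)
    (hX : ∀ i, Measurable fun ω => (w i ω, θ i ω)) (hw : ∀ᵐ ω ∂P, ∀ i, w i ω ∈ Set.Icc (0 : ℝ) 1)
    (F : Finset ℕ) (N : ℕ) :
    P {ω | ∃ n < N, ∀ i ∈ F, Z n i ω = true} =
      ∫⁻ ω, ENNReal.ofReal (1 - (1 - ∏ i ∈ F, w i ω) ^ N) ∂P := by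
  have hwm : ∀ i, Measurable (w i) := fun i => measurable_fst.comp (hX i)
  have hprodm : Measurable fun ω => ∏ i ∈ F, w i ω := Finset.measurable_prod _ fun i _ => hwm i
  have hprod : ∀ᵐ ω ∂P, ∏ i ∈ F, w i ω ∈ Set.Icc (0 : ℝ) 1 := by
    filter_upwards [hw] with ω hω
    exact ⟨Finset.prod_nonneg fun i _ => (hω i).1,
      Finset.prod_le_one (fun i _ => (hω i).1) fun i _ => (hω i).2⟩
  have hpow : ∀ k : ℕ, Integrable (fun ω => (-1) ^ k * (∏ i ∈ F, w i ω) ^ k) P := by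
    intro k
    refine Integrable.of_bound (by fun_prop) 1 ?_
    filter_upwards [hprod] with ω hω
    rw [norm_mul, norm_pow, norm_neg, norm_one, one_pow, one_mul, norm_pow, Real.norm_of_nonneg hω.1]
    exact pow_le_one₀ hω.1 hω.2
  have hexpand : ∀ x : ℝ, (1 - x) ^ N =
      ∑ S ∈ (Finset.range N).powerset, (-1) ^ S.card * x ^ S.card := by
    intro x
    have := Finset.prod_one_add (f := fun _ : ℕ => -x) (Finset.range N)
    simp only [Finset.prod_const, Finset.card_range] at this
    rw [sub_eq_add_neg, this]
    exact Finset.sum_congr rfl fun S _ => by rw [neg_pow]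
  have hint : Integrable (fun ω => (1 - ∏ i ∈ F, w i ω) ^ N) P := by
    simp only [hexpand]
    exact integrable_finsetSum _ fun S _ => hpow _
  have hcompl : P.real {ω | ∃ n < N, ∀ i ∈ F, Z n i ω = true}ᶜ =
      ∫ ω, (1 - ∏ i ∈ F, w i ω) ^ N ∂P := by
    have hind : ∀ ω, {ω | ∃ n < N, ∀ i ∈ F, Z n i ω = true}ᶜ.indicator (fun _ => (1 : ℝ)) ω =
        ∑ S ∈ (Finset.range N).powerset, (-1) ^ S.card *
          {ω | ∀ p ∈ S ×ˢ F, Z p.1 p.2 ω = true}.indicator (fun _ => (1 : ℝ)) ω := by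
      intro ω
      calc _ = ∏ n ∈ Finset.range N,
            (1 + -{ω | ∀ i ∈ F, Z n i ω = true}.indicator (fun _ => (1 : ℝ)) ω) := by
            have : ∀ n, 1 + -{ω | ∀ i ∈ F, Z n i ω = true}.indicator (fun _ => (1 : ℝ)) ω =
                if ¬ ∀ i ∈ F, Z n i ω = true then 1 else 0 := by
              intro n
              by_cases hn : ∀ i ∈ F, Z n i ω = true
              · rw [Set.indicator_of_mem (Set.mem_ofPred.2 hn), if_neg (not_not.2 hn), add_neg_cancel]
              · rw [Set.indicator_of_notMem (mt Set.mem_ofPred.1 hn), if_pos hn, neg_zero, add_zero]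
            rw [Finset.prod_congr rfl fun n _ => this n, Finset.prod_boole, Set.indicator_apply]
            refine if_congr ?_ rfl rfl
            simp
        _ = _ := by
            rw [Finset.prod_one_add]
            refine Finset.sum_congr rfl fun S _ => ?_
            rw [Finset.prod_neg, prod_indicator_row]
    have hm := (h.measurableSet_exists_row F N).compl
    rw [← mul_one (P.real _), ← smul_eq_mul, ← integral_indicator_const (1 : ℝ) hm]
    simp only [hind, hexpand]
    rw [integral_finsetSum _ fun S _ => hpow _, integral_finsetSum _ fun S _ =>
      ((integrable_const (1 : ℝ)).indicator (h.measurableSet_forall_true _)).const_mul _]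
    refine Finset.sum_congr rfl fun S _ => ?_
    rw [integral_const_mul, integral_const_mul,
      integral_indicator_const _ (h.measurableSet_forall_true _), h.measureReal_forall_true hX,
      smul_eq_mul, mul_one]
    congr 2
    ext ω
    rw [Finset.prod_product]
    simp
  have hint' : Integrable (fun ω => 1 - (1 - ∏ i ∈ F, w i ω) ^ N) P :=
    (integrable_const 1).sub hint
  rw [← ofReal_integral_eq_lintegral_ofReal hint' ?_, integral_sub (integrable_const 1) hint,
    ← hcompl, probReal_compl_eq_one_sub (h.measurableSet_exists_row F N)]
  · simp
  · filter_upwards [hprod] with ω hω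
    exact sub_nonneg.2 (pow_le_one₀ (by linarith [hω.2]) (by linarith [hω.1]))

end IsCliqueMatrix

/-! ### Integrals against the stable beta Lévy measure -/

section LevyMeasure

variable {α σ c : ℝ}

lemma measurable_stableBetaDensity : Measurable (stableBetaDensity α σ c) := by
  unfold stableBetaDensity
  fun_prop

instance : SigmaFinite (stableBetaLevy α σ c) := by
  unfold stableBetaLevy
  infer_instance

lemma lintegral_stableBetaLevy {f : ℝ → ℝ≥0∞} (hf : Measurable f) :
    ∫⁻ x, f x ∂(stableBetaLevy α σ c) =
      ∫⁻ x in Set.Ioo (0 : ℝ) 1, ENNReal.ofReal (stableBetaDensity α σ c x) * f x := by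
  rw [stableBetaLevy, lintegral_withDensity_eq_lintegral_mul _
    measurable_stableBetaDensity.ennreal_ofReal hf]
  rfl

lemma ae_mem_Ioo_stableBetaLevy : ∀ᵐ x ∂(stableBetaLevy α σ c), x ∈ Set.Ioo (0 : ℝ) 1 :=
  (withDensity_absolutelyContinuous _ _).ae_le (ae_restrict_mem measurableSet_Ioo)

lemma stableBetaDensity_const_pos (hα : 0 < α) (hσ1 : σ < 1) (hc : -σ < c) :
    0 < α * (Real.Gamma (1 + c) / (Real.Gamma (1 - σ) * Real.Gamma (c + σ))) :=
  mul_pos hα (div_pos (Real.Gamma_pos_of_pos (by linarith))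
    (mul_pos (Real.Gamma_pos_of_pos (by linarith)) (Real.Gamma_pos_of_pos (by linarith))))

/-- The moments of order `a > σ` of the Lévy measure are multiples of beta integrals. -/
lemma lintegral_rpow_stableBetaLevy_ne_top (hc : -σ < c) {a : ℝ} (ha : σ < a) :
    ∫⁻ x, ENNReal.ofReal (x ^ a) ∂(stableBetaLevy α σ c) ≠ ∞ := by
  have h1 : 0 < a - σ := by linarith
  have h2 : 0 < c + σ := by linarith
  have hB := beta_pos h1 h2
  rw [lintegral_stableBetaLevy (by fun_prop)]
  set K := α * (Real.Gamma (1 + c) / (Real.Gamma (1 - σ) * Real.Gamma (c + σ))) with hK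
  have hpt : ∀ x ∈ Set.Ioo (0 : ℝ) 1,
      ENNReal.ofReal (stableBetaDensity α σ c x) * ENNReal.ofReal (x ^ a) =
        ENNReal.ofReal (K * beta (a - σ) (c + σ)) * ENNReal.ofReal
          (1 / beta (a - σ) (c + σ) * x ^ (a - σ - 1) * (1 - x) ^ (c + σ - 1)) := by
    intro x hx
    have hx1 : 0 ≤ 1 - x := by linarith [hx.2]
    rw [← ENNReal.ofReal_mul' (Real.rpow_nonneg hx.1.le _), ← ENNReal.ofReal_mul'
      (mul_nonneg (mul_nonneg (by positivity) (Real.rpow_nonneg hx.1.le _))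
        (Real.rpow_nonneg hx1 _)), stableBetaDensity, ← hK,
      show a - σ - 1 = (-σ - 1) + a by ring, Real.rpow_add hx.1]
    congr 1
    field_simp
  rw [setLIntegral_congr_fun measurableSet_Ioo hpt, lintegral_const_mul' _ _ ENNReal.ofReal_ne_top,
    ← lintegral_betaPDF, lintegral_betaPDF_eq_one h1 h2, mul_one]
  exact ENNReal.ofReal_ne_top

lemma one_sub_one_sub_pow_le_rpow {x a : ℝ} (hx0 : 0 ≤ x) (hx1 : x ≤ 1) (ha0 : 0 ≤ a) (ha1 : a ≤ 1)
    (N : ℕ) : 1 - (1 - x) ^ N ≤ (N * x) ^ a := by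
  have hpow : 0 ≤ (1 - x) ^ N := pow_nonneg (by linarith) N
  rcases le_total 1 (N * x) with h | h
  · linarith [Real.one_le_rpow h ha0]
  · have h1 : 1 - (1 - x) ^ N ≤ N * x := by
      have := one_add_mul_le_pow (a := -x) (by linarith) N
      rw [← sub_eq_add_neg] at this
      linarith
    refine h1.trans ?_
    simpa using Real.rpow_le_rpow_of_exponent_ge' (by positivity : 0 ≤ N * x) h ha0 ha1

lemma lintegral_one_sub_pow_le {a : ℝ} (ha0 : 0 ≤ a) (ha1 : a ≤ 1) (N : ℕ) :
    ∫⁻ u, ENNReal.ofReal (1 - (1 - u) ^ N) ∂(stableBetaLevy α σ c) ≤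
      ENNReal.ofReal ((N : ℝ) ^ a) * ∫⁻ u, ENNReal.ofReal (u ^ a) ∂(stableBetaLevy α σ c) := by
  rw [← lintegral_const_mul' _ _ ENNReal.ofReal_ne_top]
  refine lintegral_mono_ae ?_
  filter_upwards [ae_mem_Ioo_stableBetaLevy] with u hu
  rw [← ENNReal.ofReal_mul (by positivity), ← Real.mul_rpow (by positivity) hu.1.le]
  exact ENNReal.ofReal_le_ofReal (one_sub_one_sub_pow_le_rpow hu.1.le hu.2.le ha0 ha1 N)

/-- The bound `1 - (1 - uv)^N ≤ (Nuv)^a`, integrated in `u` and `v`. -/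
lemma lintegral_lintegral_one_sub_pow_le {a : ℝ} (ha0 : 0 ≤ a) (ha1 : a ≤ 1) (N : ℕ) :
    ∫⁻ v, ∫⁻ u, ENNReal.ofReal (1 - (1 - u * v) ^ N)
        ∂(stableBetaLevy α σ c) ∂(stableBetaLevy α σ c) ≤
      ENNReal.ofReal ((N : ℝ) ^ a) * (∫⁻ u, ENNReal.ofReal (u ^ a) ∂(stableBetaLevy α σ c)) ^ 2 := by
  set ν := stableBetaLevy α σ c with hν
  calc _ ≤ ∫⁻ v, (ENNReal.ofReal ((N : ℝ) ^ a) * ∫⁻ u, ENNReal.ofReal (u ^ a) ∂ν) *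
        ENNReal.ofReal (v ^ a) ∂ν := by
        refine lintegral_mono_ae ?_
        filter_upwards [ae_mem_Ioo_stableBetaLevy] with v hv
        rw [mul_right_comm, ← lintegral_const_mul' _ _
          (ENNReal.mul_ne_top ENNReal.ofReal_ne_top ENNReal.ofReal_ne_top)]
        refine lintegral_mono_ae ?_
        filter_upwards [ae_mem_Ioo_stableBetaLevy] with u hu
        have huv : u * v ≤ 1 := mul_le_one₀ hu.2.le hv.1.le hv.2.le
        have huv0 : 0 ≤ u * v := mul_nonneg hu.1.le hv.1.le
        have hva := Real.rpow_nonneg hv.1.le a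
        have hN : 0 ≤ (N : ℝ) ^ a := by positivity
        rw [← ENNReal.ofReal_mul hN, ← ENNReal.ofReal_mul (mul_nonneg hN hva), mul_assoc,
          ← Real.mul_rpow hv.1.le hu.1.le, mul_comm v u,
          ← Real.mul_rpow (by positivity) huv0]
        exact ENNReal.ofReal_le_ofReal (one_sub_one_sub_pow_le_rpow huv0 huv ha0 ha1 N)
    _ = _ := by
        rw [lintegral_const_mul _ (by fun_prop), sq, mul_assoc]

/-- Atoms of size between `1 / (2N)` and `1 / N`, of which there are of order `N ^ σ` on average,
are covered by one of `N` cliques with probability bounded away from zero. -/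
lemma exists_le_lintegral_one_sub_pow (hα : 0 < α) (hσ0 : 0 < σ) (hσ1 : σ < 1) (hc : -σ < c) :
    ∃ C > 0, ∀ N : ℕ, 2 ≤ N → ENNReal.ofReal (C * (N : ℝ) ^ σ) ≤
      ∫⁻ u, ENNReal.ofReal (1 - (1 - u) ^ N) ∂(stableBetaLevy α σ c) := by
  have hKpos := stableBetaDensity_const_pos hα hσ1 hc
  set K := α * (Real.Gamma (1 + c) / (Real.Gamma (1 - σ) * Real.Gamma (c + σ))) with hK
  -- a lower bound on `[1/2, 1]` for `y ^ (c + σ - 1)`, whose exponent may have either sign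
  obtain ⟨b, hb, hbl⟩ : ∃ b > 0, ∀ y : ℝ, 1 / 2 ≤ y → y ≤ 1 → b ≤ y ^ (c + σ - 1) := by
    rcases le_total 0 (c + σ - 1) with h | h
    · exact ⟨(1 / 2) ^ (c + σ - 1), by positivity, fun y hy _ =>
        Real.rpow_le_rpow (by norm_num) hy h⟩
    · exact ⟨1, one_pos, fun y hy hy1 => Real.one_le_rpow_of_pos_of_le_one_of_nonpos
        (by linarith) hy1 h⟩
  have hk : 0 < 1 - Real.exp (-(1 / 2)) := by
    have : Real.exp (-(1 / 2)) < 1 := Real.exp_lt_one_iff.2 (by norm_num)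
    linarith
  refine ⟨K * b * (1 - Real.exp (-(1 / 2))) / 2, by positivity, fun N hN => ?_⟩
  have hN2 : (2 : ℝ) ≤ N := by exact_mod_cast hN
  have hN0 : (0 : ℝ) < N := by linarith
  have hsub : Set.Ioo (1 / (2 * N) : ℝ) (1 / N) ⊆ Set.Ioo 0 1 := fun x hx =>
    ⟨lt_trans (by positivity) hx.1, hx.2.trans_le (by rw [div_le_one hN0]; linarith)⟩
  rw [lintegral_stableBetaLevy (by fun_prop)]
  refine le_trans ?_ (lintegral_mono_set hsub)
  have hvol : volume (Set.Ioo (1 / (2 * N) : ℝ) (1 / N)) = ENNReal.ofReal (1 / (2 * N)) := by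
    rw [Real.volume_Ioo]; congr 1; field_simp; norm_num
  calc ENNReal.ofReal (K * b * (1 - Real.exp (-(1 / 2))) / 2 * (N : ℝ) ^ σ)
      = ENNReal.ofReal (K * b * (1 - Real.exp (-(1 / 2))) * (N : ℝ) ^ (σ + 1)) *
          volume (Set.Ioo (1 / (2 * N) : ℝ) (1 / N)) := by
        rw [hvol, ← ENNReal.ofReal_mul (by positivity), Real.rpow_add hN0, Real.rpow_one]
        congr 1
        field_simp
    _ = ∫⁻ _ in Set.Ioo (1 / (2 * N) : ℝ) (1 / N),
          ENNReal.ofReal (K * b * (1 - Real.exp (-(1 / 2))) * (N : ℝ) ^ (σ + 1)) := by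
        rw [setLIntegral_const]
    _ ≤ _ := by
        refine setLIntegral_mono (by
          have := @measurable_stableBetaDensity α σ c
          fun_prop) fun x hx => ?_
        have hx0 := (hsub hx).1
        have hx1 := (hsub hx).2
        have hxhalf : x ≤ 1 / 2 := hx.2.le.trans (one_div_le_one_div_of_le (by norm_num) hN2)
        have hNx : 1 / 2 ≤ x * N := by
          have := hx.1.le
          rw [div_le_iff₀ (by positivity)] at this
          linarith
        have e1 : (1 - x) ^ N ≤ Real.exp (-(1 / 2)) := by
          calc (1 - x) ^ N ≤ Real.exp (-x) ^ N :=
                pow_le_pow_left₀ (by linarith) (Real.one_sub_le_exp_neg x) N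
            _ = Real.exp (-(x * N)) := by rw [← Real.exp_nat_mul]; congr 1; ring
            _ ≤ _ := Real.exp_le_exp.2 (by linarith)
        have e2 : (N : ℝ) ^ (σ + 1) ≤ x ^ (-σ - 1) := by
          have : (N : ℝ) ≤ x⁻¹ := by
            rw [le_inv_comm₀ hN0 hx0]; simpa using hx.2.le
          calc (N : ℝ) ^ (σ + 1) ≤ x⁻¹ ^ (σ + 1) := Real.rpow_le_rpow hN0.le this (by linarith)
            _ = x ^ (-σ - 1) := by
              rw [Real.inv_rpow hx0.le, ← Real.rpow_neg hx0.le]; congr 1; ring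
        have e3 := hbl (1 - x) (by linarith) (by linarith)
        rw [← ENNReal.ofReal_mul' (by linarith)]
        refine ENNReal.ofReal_le_ofReal ?_
        rw [stableBetaDensity, ← hK]
        calc K * b * (1 - Real.exp (-(1 / 2))) * (N : ℝ) ^ (σ + 1)
            = K * (N : ℝ) ^ (σ + 1) * b * (1 - Real.exp (-(1 / 2))) := by ring
          _ ≤ K * x ^ (-σ - 1) * (1 - x) ^ (c + σ - 1) * (1 - (1 - x) ^ N) := by
            gcongr

end LevyMeasure

/-! ### Counting vertices and edges by their indices -/

lemma encard_eq_tsum_indicator {ι : Type*} (s : Set ι) :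
    (s.encard : ℝ≥0∞) = ∑' i, s.indicator (fun _ => (1 : ℝ≥0∞)) i := by
  rw [← ENNReal.tsum_set_one, tsum_subtype s fun _ => (1 : ℝ≥0∞)]

section Counting

variable {Ω 𝒱 : Type*} {θ : ℕ → Ω → 𝒱} {Z : ℕ → ℕ → Ω → Bool} {ω : Ω}

lemma encard_coverVertices (hθ : Function.Injective fun i => θ i ω) (N : ℕ) :
    (coverVertices (fun n => clique θ Z n ω) N).encard =
      {i | ∃ n < N, Z n i ω = true}.encard := by
  rw [← hθ.encard_image]
  congr 1
  ext x
  simp only [coverVertices, clique, Set.mem_ofPred_eq, Set.mem_image]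
  constructor
  · rintro ⟨n, hn, i, hi, rfl⟩
    exact ⟨i, ⟨n, hn, hi⟩, rfl⟩
  · rintro ⟨i, ⟨n, hn, hi⟩, rfl⟩
    exact ⟨n, hn, i, hi, rfl⟩

lemma encard_edgeSet_coverGraph (hθ : Function.Injective fun i => θ i ω) (N : ℕ) :
    (coverGraph (fun n => clique θ Z n ω) N).edgeSet.encard =
      {p : ℕ × ℕ | p.1 < p.2 ∧ ∃ n < N, Z n p.1 ω = true ∧ Z n p.2 ω = true}.encard := by
  have hinj : Set.InjOn (fun p : ℕ × ℕ => s(θ p.1 ω, θ p.2 ω))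
      {p : ℕ × ℕ | p.1 < p.2 ∧ ∃ n < N, Z n p.1 ω = true ∧ Z n p.2 ω = true} := by
    rintro ⟨i, j⟩ ⟨hij, -⟩ ⟨k, l⟩ ⟨hkl, -⟩ h
    rcases Sym2.eq_iff.1 h with ⟨h1, h2⟩ | ⟨h1, h2⟩
    · exact Prod.ext (hθ h1) (hθ h2)
    · have := hθ h1
      have := hθ h2
      dsimp only at *
      omega
  rw [← hinj.encard_image]
  congr 1
  ext e
  induction e using Sym2.ind with
  | _ x y =>
  simp only [SimpleGraph.mem_edgeSet, coverGraph, clique, Set.mem_ofPred_eq, Set.mem_image]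
  constructor
  · rintro ⟨hxy, n, hn, ⟨i, hi, rfl⟩, j, hj, rfl⟩
    rcases lt_trichotomy i j with hij | rfl | hij
    · exact ⟨(i, j), ⟨hij, n, hn, hi, hj⟩, rfl⟩
    · exact absurd rfl hxy
    · exact ⟨(j, i), ⟨hij, n, hn, hj, hi⟩, Sym2.eq_swap⟩
  · rintro ⟨⟨i, j⟩, ⟨hij, n, hn, hi, hj⟩, h⟩
    rcases Sym2.eq_iff.1 h with ⟨rfl, rfl⟩ | ⟨rfl, rfl⟩
    · exact ⟨fun h => hij.ne (hθ h), n, hn, ⟨i, hi, rfl⟩, j, hj, rfl⟩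
    · exact ⟨fun h => hij.ne' (hθ h), n, hn, ⟨j, hj, rfl⟩, i, hi, rfl⟩

end Counting

/-- A symmetric sum over pairs of distinct indices is twice the sum over increasing pairs. -/
lemma tsum_ite_eq_two_mul_tsum_ite_lt (f : ℕ × ℕ → ℝ≥0∞) (hf : ∀ p, f p.swap = f p) :
    ∑' p : ℕ × ℕ, (if p.1 = p.2 then 0 else f p) =
      2 * ∑' p : ℕ × ℕ, if p.1 < p.2 then f p else 0 := by
  have h1 : ∀ p : ℕ × ℕ, (if p.1 = p.2 then 0 else f p) =
      (if p.1 < p.2 then f p else 0) + if p.2 < p.1 then f p else 0 := by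
    intro p
    rcases lt_trichotomy p.1 p.2 with h | h | h
    · simp [h, h.ne, h.not_gt]
    · simp [h]
    · simp [h, h.ne', h.not_gt]
  have h2 : ∑' p : ℕ × ℕ, (if p.2 < p.1 then f p else 0) =
      ∑' p : ℕ × ℕ, if p.1 < p.2 then f p else 0 := by
    rw [← (Equiv.prodComm ℕ ℕ).tsum_eq]
    exact tsum_congr fun p => by simp [hf]
  simp only [h1]
  rw [ENNReal.tsum_add, h2, two_mul]

/-! ### Expected numbers of vertices and edges -/

namespace IsStableBetaProcess

variable {Ω 𝒱 : Type*} [MeasurableSpace Ω] [MeasurableSpace 𝒱] {P : Measure Ω}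
  {H : Measure 𝒱} [IsProbabilityMeasure H] {α σ c : ℝ} {w : ℕ → Ω → ℝ} {θ : ℕ → Ω → 𝒱}

lemma ae_mem_Icc (h : IsStableBetaProcess P α σ c H w θ) :
    ∀ᵐ ω ∂P, ∀ i, w i ω ∈ Set.Icc (0 : ℝ) 1 := by
  have hcamp := IsPoissonProcess.sum_map_eq h
  refine ae_all_iff.2 fun i => ?_
  have h1 : ∀ᵐ x ∂((stableBetaLevy α σ c).prod H), x.1 ∈ Set.Icc (0 : ℝ) 1 :=
    Measure.quasiMeasurePreserving_fst.ae
      (ae_mem_Ioo_stableBetaLevy.mono fun x hx => Set.Ioo_subset_Icc_self hx)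
  rw [← hcamp, Measure.ae_sum_iff] at h1
  exact ae_of_ae_map (h.measurable_points i).aemeasurable (h1 i)

/-- Campbell's theorem for functions of the atom sizes. -/
lemma tsum_lintegral_size (h : IsStableBetaProcess P α σ c H w θ) {f : ℝ → ℝ≥0∞}
    (hf : Measurable f) :
    ∑' i, ∫⁻ ω, f (w i ω) ∂P = ∫⁻ u, f u ∂(stableBetaLevy α σ c) := by
  have hcamp := IsPoissonProcess.sum_map_eq h
  calc _ = ∫⁻ x, f x.1 ∂((stableBetaLevy α σ c).prod H) := by
        rw [← hcamp, lintegral_sum_measure]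
        exact tsum_congr fun i =>
          (lintegral_map (hf.comp measurable_fst) (h.measurable_points i)).symm
    _ = _ := by
        rw [lintegral_prod _ (by fun_prop)]
        simp

/-- The second-order Campbell formula for functions of the sizes of two distinct atoms. -/
lemma tsum_lintegral_size_pair (h : IsStableBetaProcess P α σ c H w θ) {f : ℝ × ℝ → ℝ≥0∞}
    (hf : Measurable f) :
    ∑' p : ℕ × ℕ, (if p.1 = p.2 then 0 else ∫⁻ ω, f (w p.1 ω, w p.2 ω) ∂P) =
      ∫⁻ v, ∫⁻ u, f (v, u) ∂(stableBetaLevy α σ c) ∂(stableBetaLevy α σ c) := by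
  have hcamp := IsPoissonProcess.factorialMomentMeasure_eq h
  have hf' : Measurable fun x : (ℝ × 𝒱) × (ℝ × 𝒱) => f (x.1.1, x.2.1) := by fun_prop
  calc _ = ∫⁻ x, f (x.1.1, x.2.1)
        ∂(((stableBetaLevy α σ c).prod H).prod ((stableBetaLevy α σ c).prod H)) := by
        rw [← hcamp, factorialMomentMeasure, lintegral_sum_measure]
        refine tsum_congr fun p => ?_
        split_ifs
        · simp
        · exact (lintegral_map hf'
            ((h.measurable_points p.1).prodMk (h.measurable_points p.2))).symm
    _ = ∫⁻ x, ∫⁻ u, f (x.1, u) ∂(stableBetaLevy α σ c) ∂((stableBetaLevy α σ c).prod H) := by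
        rw [lintegral_prod _ hf'.aemeasurable]
        refine lintegral_congr fun x => ?_
        rw [lintegral_prod _ (by fun_prop)]
        simp
    _ = _ := by
        rw [lintegral_prod _ (Measurable.aemeasurable (by fun_prop))]
        simp

/-- The atoms have distinct locations: the expected number of coincidences is the mass of the
diagonal for the second factorial moment measure, zero because `H` has no atoms. -/
lemma ae_injective [StandardBorelSpace 𝒱] (h : IsStableBetaProcess P α σ c H w θ)
    (hH : ∀ x, H {x} = 0) : ∀ᵐ ω ∂P, Function.Injective fun i => θ i ω := by
  have hcamp := IsPoissonProcess.factorialMomentMeasure_eq h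
  set m := (stableBetaLevy α σ c).prod H with hm
  have hD : MeasurableSet {x : (ℝ × 𝒱) × (ℝ × 𝒱) | x.1.2 = x.2.2} :=
    measurableSet_eq_fun (by fun_prop) (by fun_prop)
  have h0 : ∀ᵐ x ∂(m.prod m), x.1.2 ≠ x.2.2 := by
    refine (Measure.ae_prod_iff_ae_ae hD.compl).2 ?_
    refine Eventually.of_forall fun x => ?_
    have hx : ∀ᵐ y ∂H, x.2 ≠ y := by
      rw [ae_iff]
      simpa using hH x.2
    exact Measure.quasiMeasurePreserving_snd.ae hx
  rw [← hcamp, factorialMomentMeasure, Measure.ae_sum_iff] at h0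
  have h1 : ∀ᵐ ω ∂P, ∀ p : ℕ × ℕ, p.1 ≠ p.2 → θ p.1 ω ≠ θ p.2 ω := by
    refine ae_all_iff.2 fun p => ?_
    by_cases hp : p.1 = p.2
    · exact Eventually.of_forall fun ω hne => absurd hp hne
    · have := h0 p
      rw [if_neg hp] at this
      filter_upwards [ae_of_ae_map
        ((h.measurable_points p.1).prodMk (h.measurable_points p.2)).aemeasurable this]
        with ω hω _ using hω
  filter_upwards [h1] with ω hω i j hij
  by_contra hne
  exact hω (i, j) hne hij

variable [IsProbabilityMeasure P] [StandardBorelSpace 𝒱] {Z : ℕ → ℕ → Ω → Bool}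

theorem expectedVertices_eq (h : IsStableBetaProcess P α σ c H w θ) (hH : ∀ x, H {x} = 0)
    (hZ : IsCliqueMatrix P w θ Z) (N : ℕ) :
    expectedVertices P θ Z N =
      ∫⁻ u, ENNReal.ofReal (1 - (1 - u) ^ N) ∂(stableBetaLevy α σ c) := by
  rw [← h.tsum_lintegral_size (f := fun u => ENNReal.ofReal (1 - (1 - u) ^ N)) (by fun_prop)]
  have hS : ∀ i, MeasurableSet {ω | ∃ n < N, Z n i ω = true} := fun i => by
    simpa using hZ.measurableSet_exists_row {i} N
  calc expectedVertices P θ Z N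
      = ∫⁻ ω, ∑' i, {ω | ∃ n < N, Z n i ω = true}.indicator (fun _ => (1 : ℝ≥0∞)) ω ∂P := by
        refine lintegral_congr_ae ?_
        filter_upwards [h.ae_injective hH] with ω hω
        rw [encard_coverVertices hω, encard_eq_tsum_indicator]
        rfl
    _ = _ := by
        rw [lintegral_tsum fun i => (measurable_const.indicator (hS i)).aemeasurable]
        refine tsum_congr fun i => ?_
        rw [lintegral_indicator_const (hS i), one_mul]
        simpa using hZ.measure_exists_row h.measurable_points h.ae_mem_Icc {i} N

theorem expectedEdges_eq (h : IsStableBetaProcess P α σ c H w θ) (hH : ∀ x, H {x} = 0)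
    (hZ : IsCliqueMatrix P w θ Z) (N : ℕ) :
    expectedEdges P θ Z N = (1 / 2) * ∫⁻ v, ∫⁻ u, ENNReal.ofReal (1 - (1 - u * v) ^ N)
      ∂(stableBetaLevy α σ c) ∂(stableBetaLevy α σ c) := by
  have hS : ∀ p : ℕ × ℕ, MeasurableSet
      {ω | p.1 < p.2 ∧ ∃ n < N, Z n p.1 ω = true ∧ Z n p.2 ω = true} := fun p => by
    have := hZ.measurableSet_exists_row {p.1, p.2} N
    simp only [Finset.forall_mem_insert, Finset.mem_singleton, forall_eq] at this
    exact (MeasurableSet.const (p.1 < p.2)).inter this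
  have hcount : expectedEdges P θ Z N = ∑' p : ℕ × ℕ, if p.1 < p.2 then
      ∫⁻ ω, ENNReal.ofReal (1 - (1 - w p.2 ω * w p.1 ω) ^ N) ∂P else 0 := by
    calc expectedEdges P θ Z N
        = ∫⁻ ω, ∑' p : ℕ × ℕ, {ω | p.1 < p.2 ∧ ∃ n < N, Z n p.1 ω = true ∧
            Z n p.2 ω = true}.indicator (fun _ => (1 : ℝ≥0∞)) ω ∂P := by
          refine lintegral_congr_ae ?_
          filter_upwards [h.ae_injective hH] with ω hω
          rw [encard_edgeSet_coverGraph hω, encard_eq_tsum_indicator]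
          rfl
      _ = _ := by
          rw [lintegral_tsum fun p => (measurable_const.indicator (hS p)).aemeasurable]
          refine tsum_congr fun p => ?_
          rw [lintegral_indicator_const (hS p), one_mul]
          split_ifs with hp
          · have := hZ.measure_exists_row h.measurable_points h.ae_mem_Icc {p.1, p.2} N
            simp only [Finset.prod_pair hp.ne, Finset.forall_mem_insert,
              Finset.mem_singleton, forall_eq] at this
            simpa [hp, mul_comm (w p.2 _)] using this
          · simp [hp]
  rw [hcount, ← h.tsum_lintegral_size_pair
      (f := fun x => ENNReal.ofReal (1 - (1 - x.2 * x.1) ^ N)) (by fun_prop),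
    tsum_ite_eq_two_mul_tsum_ite_lt
      (fun p => ∫⁻ ω, ENNReal.ofReal (1 - (1 - w p.2 ω * w p.1 ω) ^ N) ∂P)
      (fun p => by simp only [Prod.fst_swap, Prod.snd_swap, mul_comm]),
    ← mul_assoc, one_div, ENNReal.inv_mul_cancel two_ne_zero ENNReal.ofNat_ne_top, one_mul]

end IsStableBetaProcess

/-! ### Growth rates -/

theorem proposition2 {Ω 𝒱 : Type*} [MeasurableSpace Ω] (P : Measure Ω) [IsProbabilityMeasure P]
    [MeasurableSpace 𝒱] [StandardBorelSpace 𝒱]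
    (H : Measure 𝒱) [IsProbabilityMeasure H] (hH : ∀ x, H {x} = 0)
    (α σ c : ℝ) (hα : 0 < α) (hσ0 : 0 < σ) (hσ1 : σ < 1) (hc : -σ < c)
    (w : ℕ → Ω → ℝ) (θ : ℕ → Ω → 𝒱) (Z : ℕ → ℕ → Ω → Bool)
    (hμ : IsStableBetaProcess P α σ c H w θ) (hZ : IsCliqueMatrix P w θ Z) :
    -- the formula for the expected number of edges
    (∀ N : ℕ, expectedEdges P θ Z N =
      (1 / 2) * ∫⁻ v, ∫⁻ u, ENNReal.ofReal (1 - (1 - u * v) ^ N)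
        ∂(stableBetaLevy α σ c) ∂(stableBetaLevy α σ c)) ∧
    -- the expected numbers of edges and vertices are finite
    (∀ N : ℕ, expectedEdges P θ Z N ≠ ∞ ∧ expectedVertices P θ Z N ≠ ∞) ∧
    -- growth of the number of edges with the number of cliques
    ((fun N : ℕ => (expectedEdges P θ Z N).toReal) =O[atTop]
      fun N : ℕ => min ((N : ℝ) ^ ((1 + σ) / 2)) ((N : ℝ) ^ (3 * σ / 2))) ∧
    -- growth of the number of edges with the number of vertices
    ((fun N : ℕ => (expectedEdges P θ Z N).toReal) =O[atTop]
      fun N : ℕ => min ((expectedVertices P θ Z N).toReal ^ ((1 + σ) / (2 * σ)))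
        ((expectedVertices P θ Z N).toReal ^ ((3 : ℝ) / 2))) ∧
    -- sparsity: sub-quadratic growth in the number of vertices
    ((fun N : ℕ => (expectedEdges P θ Z N).toReal) =o[atTop]
      fun N : ℕ => (expectedVertices P θ Z N).toReal ^ 2) := by
  set a := min ((1 + σ) / 2) (3 * σ / 2) with ha
  have haσ : σ < a := lt_min (by linarith) (by linarith)
  have ha1 : a ≤ 1 := (min_le_left _ _).trans (by linarith)
  set M := ∫⁻ u, ENNReal.ofReal (u ^ a) ∂(stableBetaLevy α σ c) with hM
  have hMtop : M ≠ ∞ := lintegral_rpow_stableBetaLevy_ne_top hc haσ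
  have hEle : ∀ N : ℕ, expectedEdges P θ Z N ≤ ENNReal.ofReal ((N : ℝ) ^ a) * M ^ 2 := fun N => by
    rw [hμ.expectedEdges_eq hH hZ]
    refine (mul_le_of_le_one_left' ?_).trans
      (lintegral_lintegral_one_sub_pow_le (hσ0.trans haσ).le ha1 N)
    simp
  have hEtop : ∀ N, expectedEdges P θ Z N ≠ ∞ := fun N =>
    ne_top_of_le_ne_top (ENNReal.mul_ne_top ENNReal.ofReal_ne_top (ENNReal.pow_ne_top hMtop))
      (hEle N)
  have hVtop : ∀ N, expectedVertices P θ Z N ≠ ∞ := fun N => by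
    rw [hμ.expectedVertices_eq hH hZ]
    exact ne_top_of_le_ne_top (ENNReal.mul_ne_top ENNReal.ofReal_ne_top hMtop)
      (lintegral_one_sub_pow_le (hσ0.trans haσ).le ha1 N)
  obtain ⟨C, hC, hVC⟩ := exists_le_lintegral_one_sub_pow (c := c) hα hσ0 hσ1 hc
  have hV : ∀ N : ℕ, 2 ≤ N → (N : ℝ) ^ σ ≤ C⁻¹ * (expectedVertices P θ Z N).toReal := by
    intro N hN
    have := hVC N hN
    rw [← hμ.expectedVertices_eq hH hZ] at this
    have := (ENNReal.ofReal_le_iff_le_toReal (hVtop N)).1 this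
    rw [inv_mul_eq_div, le_div_iff₀' hC]
    exact this
  -- the exponents of `V` are those of `N` divided by `σ`
  have hpow : ∀ s : ℝ, 0 ≤ s → (fun N : ℕ => (N : ℝ) ^ (σ * s)) =O[atTop]
      fun N : ℕ => (expectedVertices P θ Z N).toReal ^ s := by
    intro s hs
    refine IsBigO.of_bound (C⁻¹ ^ s) ?_
    filter_upwards [eventually_ge_atTop 2] with N hN
    have hVN : 0 ≤ (expectedVertices P θ Z N).toReal := ENNReal.toReal_nonneg
    rw [Real.norm_of_nonneg (by positivity), Real.norm_of_nonneg (by positivity),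
      ← Real.mul_rpow (by positivity) hVN, Real.rpow_mul (by positivity)]
    exact Real.rpow_le_rpow (by positivity) (hV N hN) hs
  have hEa : (fun N : ℕ => (expectedEdges P θ Z N).toReal) =O[atTop]
      fun N : ℕ => (N : ℝ) ^ a := by
    refine IsBigO.of_bound (M ^ 2).toReal (Eventually.of_forall fun N => ?_)
    have := ENNReal.toReal_mono
      (ENNReal.mul_ne_top ENNReal.ofReal_ne_top (ENNReal.pow_ne_top hMtop)) (hEle N)
    rw [ENNReal.toReal_mul, ENNReal.toReal_ofReal (by positivity), mul_comm] at this
    rwa [Real.norm_of_nonneg ENNReal.toReal_nonneg, Real.norm_of_nonneg (by positivity)]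
  have hmono : ∀ b : ℝ, a ≤ b → (fun N : ℕ => (N : ℝ) ^ a) =O[atTop] fun N : ℕ => (N : ℝ) ^ b := by
    intro b hab
    refine IsBigO.of_bound 1 ?_
    filter_upwards [eventually_ge_atTop 1] with N hN
    rw [Real.norm_of_nonneg (by positivity), Real.norm_of_nonneg (by positivity), one_mul]
    exact Real.rpow_le_rpow_of_exponent_le (by exact_mod_cast hN) hab
  have hmin : ∀ f g h : ℕ → ℝ, f =O[atTop] g → f =O[atTop] h →
      f =O[atTop] fun N => min (g N) (h N) := by
    intro f g h hg hh
    obtain ⟨A, hA⟩ := hg.bound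
    obtain ⟨B, hB⟩ := hh.bound
    refine IsBigO.of_bound (max A B) ?_
    filter_upwards [hA, hB] with N h1 h2
    rcases min_choice (g N) (h N) with h | h <;> rw [h]
    · exact h1.trans (by gcongr; exact le_max_left _ _)
    · exact h2.trans (by gcongr; exact le_max_right _ _)
  refine ⟨hμ.expectedEdges_eq hH hZ, fun N => ⟨hEtop N, hVtop N⟩,
    hmin _ _ _ (hEa.trans (hmono _ (min_le_left _ _))) (hEa.trans (hmono _ (min_le_right _ _))),
    hmin _ _ _ ?_ ?_, ?_⟩
  · have := hpow ((1 + σ) / (2 * σ)) (by positivity)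
    rw [show σ * ((1 + σ) / (2 * σ)) = (1 + σ) / 2 by field_simp] at this
    exact (hEa.trans (hmono _ (min_le_left _ _))).trans this
  · have := hpow (3 / 2) (by norm_num)
    rw [show σ * (3 / 2) = 3 * σ / 2 by ring] at this
    exact (hEa.trans (hmono _ (min_le_right _ _))).trans this
  · have h2 := hpow 2 (by norm_num)
    simp only [Real.rpow_two] at h2
    have ha2 : a < σ * 2 := (min_le_right _ _).trans_lt (by linarith)
    have hlt : (fun N : ℕ => (N : ℝ) ^ a) =o[atTop] fun N : ℕ => (N : ℝ) ^ (σ * 2) := by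
      refine (isLittleO_iff_tendsto' ?_).2 ?_
      · filter_upwards [eventually_gt_atTop 0] with N hN h0
        exact absurd h0 (Real.rpow_pos_of_pos (by exact_mod_cast hN) _).ne'
      · refine ((tendsto_rpow_neg_atTop (sub_pos.2 ha2)).comp
          tendsto_natCast_atTop_atTop).congr' ?_
        filter_upwards [eventually_gt_atTop 0] with N hN
        rw [Function.comp_apply, neg_sub, Real.rpow_sub (by exact_mod_cast hN)]
    exact (hEa.trans_isLittleO hlt).trans_isBigO h2
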